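/- Let $F$ be a non-archimedean local field of residual characteristic $\neq 2$, with ring of integers $R$, uniformizer $\pi$, residue field of cardinality $q$, and absolute value normalized by $|\pi|=q^{-1}$. Let $\psi:F\to\mathbb{C}^\times$ be a (continuous, unitary) additive character that is trivial on $R$ but not on $\pi^{-1}R$. Let $dx$ be the Haar measure on $F$ giving $R$ volume $1$, and $d^\times\alpha$ the Haar measure on $F^\times$ giving $R^\times$ volume $1$. Let $J$ be the $5\times5$ matrix with ones on the antidiagonal and zeros elsewhere, $G=\{g\in SL(5,F): {}^tgJg=J\}$, and let $K$ be the subgroup of elements of $G$ with entries in $R$. Let $S=\{x\in F^5: 2x_1x_5+2x_2x_4+x_3^2=1\}$. Put $v_0={}^t(0,0,1,0,0)$, $v_1={}^t(1/2,0,0,0,1)$, $a_\alpha=\mathrm{diag}(\alpha,1,1,1,\alpha^{-1})$ for $\alpha\in F^\times$, $$n(x_1,x_2,x_3)=\begin{pmatrix}1&-x_3&-x_2&-x_1&-x_1x_3-\frac12x_2^2\\0&1&0&0&x_1\\0&0&1&0&x_2\\0&0&0&1&x_3\\0&0&0&0&1\end{pmatrix},\qquad \gamma_0=\begin{pmatrix}\frac12&0&\frac12&0&-\frac14\\0&1&0&0&0\\-1&0&0&0&-\frac12\\0&0&0&1&0\\-1&0&1&0&\frac12\end{pmatrix},$$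 so that $\gamma_0\in G$ and $\gamma_0v_0=v_1$. For a function $\phi$ on $S$ and $\alpha\in F^\times$ define the orbital integral (in the split case) $$\Psi(\alpha,\phi)=\int_{F^3}\phi\bigl(n(x_1,x_2,x_3)\,a_\alpha\gamma_0v_0\bigr)\,\psi(x_2)\,dx_1\,dx_2\,dx_3 .$$ For $r\ge0$ let $\Phi_r=\sum_{i=0}^r\phi_i$, where $\phi_i$ is the characteristic function of the $K$-orbit of $a_{\pi^i}v_1$. **Proposition 3.5.** Let $r\ge 1$ be an integer and let $\chi:F^\times\to\mathbb{C}^\times$ be a continuous character. Then $\Phi_r$ is the characteristic function of $\{x\in S: |x_i|\le q^r \text{ for } 1\le i\le 5\}$; the integrals defining $\Psi(\alpha,\Phi_r)$, for every $\alpha\in F^\times$, and $\int_{F^\times}\Psi(\alpha,\Phi_r)\chi(\alpha)\,d^\times\alpha$ converge absolutely; and $$\int_{F^\times}\Psi(\alpha,\Phi_r)\,\chi(\alpha)\,d^\times\alpha=\begin{cases} qX^{1-r}+X^{-r}, & \text{if } \chi \text{ is unramified (trivial on } R^\times), \text{ where } X=\chi(\pi)^{-1},\\ 0, & \text{if } \chi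 \text{ is ramified.}\end{cases}$$ -/

import Mathlib

open MeasureTheory
open scoped Matrix

noncomputable section

namespace OrbitalIntegral

/-! ### The field

A non-archimedean local field is a locally compact (equivalently: proper), nontrivially normed
field with an ultrametric norm. That the norm is the normalized absolute value is a hypothesis of
the theorem. -/

section LocalField

variable (F : Type*) [NontriviallyNormedField F] [IsUltrametricDist F]

/-- The ring of integers `R = {x : |x| ≤ 1}`. -/
abbrev R : ValuationSubring F := (NormedField.valuation (K := F)).valuationSubring

/-- The residue field of `R`. -/
abbrev Residue : Type _ := IsLocalRing.ResidueField (R F)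

/-- The cardinality `q` of the residue field. -/
def q : ℕ := Nat.card (Residue F)

variable {F}

/-- `ϖ` generates the maximal ideal of `R`. -/
def IsUniformizer (ϖ : Fˣ) : Prop :=
  ∃ p : R F, (p : F) = ϖ ∧ IsLocalRing.maximalIdeal (R F) = Ideal.span {p}

/-- The additive character `ψ` has conductor `R`: it is trivial on `R`, but not on `ϖ⁻¹ R`. -/
def HasConductorR (ψ : AddChar F Circle) (ϖ : Fˣ) : Prop :=
  (∀ x ∈ R F, ψ x = 1) ∧ ∃ x ∈ R F, ψ ((ϖ : F)⁻¹ * x) ≠ 1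

/-- A character of `Fˣ` is unramified if it is trivial on `Rˣ = {u : |u| = 1}`. -/
def IsUnramified (χ : Fˣ →* ℂˣ) : Prop := ∀ u : Fˣ, ‖(u : F)‖ = 1 → χ u = 1

end LocalField

/-! ### The group `SO(3,2)` and the sphere `S`, in the split case -/

section Group

variable (F : Type*) [NontriviallyNormedField F] [IsUltrametricDist F]

/-- The matrix with ones on the antidiagonal and zeros elsewhere. -/
def J₅ : Matrix (Fin 5) (Fin 5) F :=
  !![0, 0, 0, 0, 1;
     0, 0, 0, 1, 0;
     0, 0, 1, 0, 0;
     0, 1, 0, 0, 0;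
     1, 0, 0, 0, 0]

/-- `G = SO(3,2; F)`, where `J = J₅`. -/
def G : Set (Matrix (Fin 5) (Fin 5) F) := {g | g.det = 1 ∧ gᵀ * J₅ F * g = J₅ F}

/-- `K = SO(3,2; R)`. -/
def K : Set (Matrix (Fin 5) (Fin 5) F) := {g | g ∈ G F ∧ ∀ i j, g i j ∈ R F}

/-- The sphere `S = {v : ᵗv J v = 1}`. -/
def S : Set (Fin 5 → F) := {v | v ⬝ᵥ (J₅ F *ᵥ v) = 1}

/-- The base point `v₀` of `S`, whose stabilizer in `G` is `C = SO(2,2; F)`. -/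
def v₀ : Fin 5 → F := ![0, 0, 1, 0, 0]

/-- The point `v₁` of `S`; it is equal to `γ₀ v₀`. -/
def v₁ : Fin 5 → F := ![1 / 2, 0, 0, 0, 1]

/-- The element `γ₀` of `G`. -/
def γ₀ : Matrix (Fin 5) (Fin 5) F :=
  !![1 / 2, 0, 1 / 2, 0, -(1 / 4);
     0,     1, 0,     0, 0;
     -1,    0, 0,     0, -(1 / 2);
     0,     0, 0,     1, 0;
     -1,    0, 1,     0, 1 / 2]

variable {F}

/-- The element `a_α = diag(α, 1, 1, 1, α⁻¹)` of the torus `A`. -/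
def a (α : Fˣ) : Matrix (Fin 5) (Fin 5) F :=
  Matrix.diagonal ![(α : F), 1, 1, 1, (α : F)⁻¹]

/-- The element `n(x₁, x₂, x₃)` of the unipotent group `N ≃ F³`. -/
def n (x₁ x₂ x₃ : F) : Matrix (Fin 5) (Fin 5) F :=
  !![1, -x₃, -x₂, -x₁, -x₁ * x₃ - x₂ ^ 2 / 2;
     0, 1,   0,   0,   x₁;
     0, 0,   1,   0,   x₂;
     0, 0,   0,   1,   x₃;
     0, 0,   0,   0,   1]

/-- The `K`-orbit of `d_i v₁` where `d_i = diag(ϖ^i, 1, 1, 1, ϖ^(-i))`. -/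
def orbit (ϖ : Fˣ) (i : ℕ) : Set (Fin 5 → F) :=
  {v | ∃ k ∈ K F, v = k *ᵥ (a (ϖ ^ i) *ᵥ v₁ F)}

/-- `Φ_r = φ_0 + ⋯ + φ_r`, where `φ_i` is the characteristic function of the orbit `K d_i v₁`. -/
def Φ (ϖ : Fˣ) (r : ℕ) (v : Fin 5 → F) : ℂ :=
  ∑ i ∈ Finset.range (r + 1), (orbit ϖ i).indicator (fun _ => (1 : ℂ)) v

end Group

/-! ### The orbital integral and its Mellin transform -/

section Integral

variable {F : Type*} [NontriviallyNormedField F]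

/-- The integrand `φ(n a_α γ₀ v₀) ψ_N(n)` of the orbital integral, with `n = n(x₁, x₂, x₃)` and
`ψ_N(n) = ψ(x₂)`. -/
def orbitalIntegrand (ψ : AddChar F Circle) (φ : (Fin 5 → F) → ℂ) (α : Fˣ) (x : F × F × F) : ℂ :=
  φ (n x.1 x.2.1 x.2.2 *ᵥ (a α *ᵥ (γ₀ F *ᵥ v₀ F))) * (ψ x.2.1 : ℂ)

variable [MeasurableSpace F]

/-- The orbital integral `Ψ(α, φ) = ∫_N φ(n a_α γ₀ v₀) ψ_N(n) dn`, where `dn = dx₁ dx₂ dx₃`. -/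
def Ψ (μ : Measure F) (ψ : AddChar F Circle) (φ : (Fin 5 → F) → ℂ) (α : Fˣ) : ℂ :=
  ∫ x, orbitalIntegrand ψ φ α x ∂(μ.prod (μ.prod μ))

end Integral

end OrbitalIntegral

end

noncomputable section

namespace OrbitalIntegral

section ValueGroup

variable {F : Type*} [NontriviallyNormedField F] [IsUltrametricDist F]

theorem mem_R_iff {x : F} : x ∈ R F ↔ ‖x‖ ≤ 1 := by
  rw [Valuation.mem_valuationSubring_iff, ← NNReal.coe_le_coe]
  rfl

theorem mem_maximalIdeal_iff (x : R F) :
    x ∈ IsLocalRing.maximalIdeal (R F) ↔ ‖(x : F)‖ < 1 := by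
  rw [← NNReal.coe_one, ← coe_nnnorm, NNReal.coe_lt_coe]
  exact (ValuationSubring.valuation_lt_one_iff (R F) x).trans
    (Valuation.isEquiv_valuation_valuationSubring _).lt_one_iff_lt_one.symm

theorem norm_two (h_two : (2 : Residue F) ≠ 0) : ‖(2 : F)‖ = 1 := by
  have hle : ‖(2 : F)‖ ≤ 1 := by
    have := IsUltrametricDist.norm_natCast_le_one F 2
    simpa using this
  refine le_antisymm hle (not_lt.1 fun hlt => h_two ?_)
  have h : (2 : R F) ∈ IsLocalRing.maximalIdeal (R F) := (mem_maximalIdeal_iff _).2 hlt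
  rw [← map_ofNat (IsLocalRing.residue (R F)) 2]
  exact (IsLocalRing.residue_eq_zero_iff _).2 h

variable {ϖ : Fˣ}

theorem IsUniformizer.norm_lt_one_iff (hϖ : IsUniformizer ϖ) {x : F} :
    ‖x‖ < 1 ↔ ‖x‖ ≤ ‖(ϖ : F)‖ := by
  obtain ⟨p, hp, hm⟩ := hϖ
  have hp1 : ‖(ϖ : F)‖ < 1 := by
    rw [← hp, ← mem_maximalIdeal_iff, hm]
    exact Ideal.mem_span_singleton_self p
  refine ⟨fun hx => ?_, fun hx => hx.trans_lt hp1⟩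
  have hxm : (⟨x, mem_R_iff.2 hx.le⟩ : R F) ∈ IsLocalRing.maximalIdeal (R F) :=
    (mem_maximalIdeal_iff _).2 hx
  rw [hm, Ideal.mem_span_singleton] at hxm
  obtain ⟨c, hc⟩ := hxm
  have hx' : x = (ϖ : F) * c := by rw [← hp]; exact congrArg Subtype.val hc
  rw [hx', norm_mul]
  exact mul_le_of_le_one_right (norm_nonneg _) (mem_R_iff.1 c.2)

theorem IsUniformizer.one_lt_q (hϖ : IsUniformizer ϖ) (h_norm : ‖(ϖ : F)‖ = (q F : ℝ)⁻¹) :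
    1 < (q F : ℝ) := by
  have h1 : ‖(ϖ : F)‖ < 1 := hϖ.norm_lt_one_iff.2 le_rfl
  have h0 : 0 < ‖(ϖ : F)‖ := norm_pos_iff.2 ϖ.ne_zero
  rw [h_norm] at h0 h1
  exact (inv_lt_one₀ (inv_pos.1 h0)).1 h1

/-- Every nonzero element has norm an integral power of `q`. -/
theorem IsUniformizer.exists_norm_eq_zpow (hϖ : IsUniformizer ϖ)
    (h_norm : ‖(ϖ : F)‖ = (q F : ℝ)⁻¹) {x : F} (hx : x ≠ 0) :
    ∃ k : ℤ, ‖x‖ = (q F : ℝ) ^ k := by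
  have hq := hϖ.one_lt_q h_norm
  have hq0 : 0 < (q F : ℝ) := zero_lt_one.trans hq
  obtain ⟨k, hk1, hk2⟩ := exists_mem_Ioc_zpow (norm_pos_iff.2 hx) hq
  refine ⟨k + 1, le_antisymm hk2 (not_lt.1 fun hlt => ?_)⟩
  have hnorm : ‖x * (ϖ : F) ^ (k + 1)‖ = ‖x‖ * ((q F : ℝ) ^ (k + 1))⁻¹ := by
    rw [norm_mul, norm_zpow, h_norm, inv_zpow]
  have hpos : 0 < (q F : ℝ) ^ (k + 1) := zpow_pos hq0 _
  have h1 : ‖x * (ϖ : F) ^ (k + 1)‖ < 1 := by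
    rw [hnorm, ← div_eq_mul_inv, div_lt_one hpos]; exact hlt
  have h2 := hϖ.norm_lt_one_iff.1 h1
  rw [hnorm, h_norm, ← div_eq_mul_inv, div_le_iff₀ hpos, zpow_add_one₀ hq0.ne',
    mul_comm ((q F : ℝ) ^ k), inv_mul_cancel_left₀ hq0.ne'] at h2
  exact absurd hk1 (not_lt.2 h2)

/-- The gap between consecutive absolute values, in multiplicative form. -/
theorem IsUniformizer.mul_norm_le_of_norm_lt (hϖ : IsUniformizer ϖ)
    (h_norm : ‖(ϖ : F)‖ = (q F : ℝ)⁻¹) {x y : F} (h : ‖x‖ < ‖y‖) :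
    (q F : ℝ) * ‖x‖ ≤ ‖y‖ := by
  have hq0 := zero_lt_one.trans (hϖ.one_lt_q h_norm)
  have hy : 0 < ‖y‖ := (norm_nonneg x).trans_lt h
  have h1 : ‖x / y‖ < 1 := by rw [norm_div, div_lt_one hy]; exact h
  rw [hϖ.norm_lt_one_iff, h_norm, norm_div, div_le_iff₀ hy, inv_mul_eq_div,
    le_div_iff₀ hq0] at h1
  linarith

theorem IsUniformizer.mul_norm_le_of_norm_lt_zpow (hϖ : IsUniformizer ϖ)
    (h_norm : ‖(ϖ : F)‖ = (q F : ℝ)⁻¹) {x : F} {k : ℤ} (h : ‖x‖ < (q F : ℝ) ^ k) :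
    (q F : ℝ) * ‖x‖ ≤ (q F : ℝ) ^ k := by
  have hk : (q F : ℝ) ^ k = ‖(ϖ : F) ^ (-k)‖ := by rw [norm_zpow, h_norm, inv_zpow, zpow_neg, inv_inv]
  rw [hk] at h ⊢
  exact hϖ.mul_norm_le_of_norm_lt h_norm h

/-- The ball of radius `q` is the disjoint union of `q` translates of the ring of integers. -/
theorem IsUniformizer.measure_norm_le_q [MeasurableSpace F] [BorelSpace F]
    (hϖ : IsUniformizer ϖ) (h_norm : ‖(ϖ : F)‖ = (q F : ℝ)⁻¹)
    (μ : Measure F) [μ.IsAddHaarMeasure] (hμ : μ {x : F | ‖x‖ ≤ 1} = 1) :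
    μ {x : F | ‖x‖ ≤ q F} = q F := by
  have hq0 := zero_lt_one.trans (hϖ.one_lt_q h_norm)
  have : Finite (Residue F) := Nat.finite_of_card_ne_zero (by
    have : q F ≠ 0 := by exact_mod_cast hq0.ne'
    exact this)
  have := Fintype.ofFinite (Residue F)
  obtain ⟨s, hs⟩ := (IsLocalRing.residue_surjective (R := R F)).hasRightInverse
  let T : Residue F → Set F := fun c => (fun x => -((ϖ : F)⁻¹ * (s c : F)) + x) ⁻¹' {x | ‖x‖ ≤ 1}
  have hT : ∀ c x, x ∈ T c ↔ ‖(ϖ : F) * x - (s c : F)‖ < 1 := by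
    intro c x
    have : (ϖ : F) * x - (s c : F) = (ϖ : F) * (-((ϖ : F)⁻¹ * (s c : F)) + x) := by
      have := ϖ.ne_zero
      field_simp
      ring
    rw [this, hϖ.norm_lt_one_iff, norm_mul,
      mul_le_iff_le_one_right (norm_pos_iff.2 ϖ.ne_zero)]
    rfl
  have hcover : {x : F | ‖x‖ ≤ q F} = ⋃ c, T c := by
    ext x
    have hx : ‖x‖ ≤ q F ↔ ‖(ϖ : F) * x‖ ≤ 1 := by
      rw [norm_mul, h_norm, inv_mul_le_iff₀ hq0, mul_one]
    rw [Set.mem_ofPred_eq, hx, Set.mem_iUnion]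
    constructor
    · intro h
      let y : R F := ⟨(ϖ : F) * x, mem_R_iff.2 h⟩
      refine ⟨IsLocalRing.residue _ y, (hT _ _).2 ?_⟩
      have : y - s (IsLocalRing.residue _ y) ∈ IsLocalRing.maximalIdeal (R F) := by
        rw [← IsLocalRing.residue_eq_zero_iff, map_sub, hs, sub_self]
      exact (mem_maximalIdeal_iff _).1 this
    · rintro ⟨c, hc⟩
      have h1 := ((hT _ _).1 hc).le
      have h2 := IsUltrametricDist.norm_add_le_max ((ϖ : F) * x - (s c : F)) (s c)
      rw [sub_add_cancel] at h2
      exact h2.trans (max_le h1 (mem_R_iff.1 (s c).2))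
  have hdisj : Pairwise (Function.onFun Disjoint T) := by
    intro c d hcd
    refine Set.disjoint_left.2 fun x hx hy => hcd ?_
    have h1 := (hT _ _).1 hx
    have h2 := (hT _ _).1 hy
    have h3 : ‖((s c - s d : R F) : F)‖ < 1 := by
      have h := IsUltrametricDist.norm_add_le_max
        ((ϖ : F) * x - (s d : F)) (-((ϖ : F) * x - (s c : F)))
      rw [norm_neg, ← sub_eq_add_neg, sub_sub_sub_cancel_left] at h
      exact h.trans_lt (max_lt h2 h1)
    rw [← mem_maximalIdeal_iff, ← IsLocalRing.residue_eq_zero_iff, map_sub, hs, hs,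
      sub_eq_zero] at h3
    exact h3
  have hmeas : MeasurableSet {x : F | ‖x‖ ≤ 1} :=
    (isClosed_le continuous_norm continuous_const).measurableSet
  rw [hcover, measure_iUnion hdisj fun c => hmeas.preimage (measurable_const_add _)]
  simp only [T, measure_preimage_add, hμ]
  rw [tsum_fintype, Finset.sum_const, nsmul_one, Finset.card_univ, ← Nat.card_eq_fintype_card]
  rfl

end ValueGroup

section Orbits

variable {F : Type*} [NontriviallyNormedField F]

theorem J₅_mul_self : J₅ F * J₅ F = 1 := by
  ext i j
  fin_cases i <;> fin_cases j <;> simp [J₅, Matrix.mul_apply, Fin.sum_univ_five]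

theorem mem_S_iff {v : Fin 5 → F} : v ∈ S F ↔ 2 * v 0 * v 4 + 2 * v 1 * v 3 + v 2 ^ 2 = 1 := by
  have : v ⬝ᵥ (J₅ F *ᵥ v) = 2 * v 0 * v 4 + 2 * v 1 * v 3 + v 2 ^ 2 := by
    simp [J₅, dotProduct, Matrix.mulVec, Fin.sum_univ_five]
    ring
  rw [S, Set.mem_ofPred_eq, this]

theorem mulVec_mem_S {g : Matrix (Fin 5) (Fin 5) F} (hg : g ∈ G F) {v : Fin 5 → F} :
    g *ᵥ v ∈ S F ↔ v ∈ S F := by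
  have : (g *ᵥ v) ⬝ᵥ (J₅ F *ᵥ (g *ᵥ v)) = v ⬝ᵥ (J₅ F *ᵥ v) := by
    conv_rhs => rw [← hg.2]
    rw [← Matrix.mulVec_mulVec, ← Matrix.mulVec_mulVec, Matrix.dotProduct_mulVec v gᵀ,
      Matrix.vecMul_transpose]
  rw [S, Set.mem_ofPred_eq, Set.mem_ofPred_eq, this]

theorem norm_mulVec_le [IsUltrametricDist F] {g : Matrix (Fin 5) (Fin 5) F} (hg : ∀ i j, g i j ∈ R F) (v : Fin 5 → F) :
    ‖g *ᵥ v‖ ≤ ‖v‖ := by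
  refine (pi_norm_le_iff_of_nonneg (norm_nonneg _)).2 fun i => ?_
  rw [Matrix.mulVec, dotProduct]
  refine IsUltrametricDist.norm_sum_le_of_forall_le_of_nonneg (M := F)
    (f := fun j => g i j * v j) (norm_nonneg v) fun j _ => ?_
  rw [norm_mul]
  exact (mul_le_of_le_one_left (norm_nonneg _) (mem_R_iff.1 (hg i j))).trans (norm_le_pi_norm v j)

theorem mul_entries_mem [IsUltrametricDist F] {g h : Matrix (Fin 5) (Fin 5) F} (hg : ∀ i j, g i j ∈ R F)
    (hh : ∀ i j, h i j ∈ R F) (i j : Fin 5) : (g * h) i j ∈ R F := by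
  rw [Matrix.mul_apply]
  exact sum_mem fun k _ => mul_mem (hg i k) (hh k j)

theorem J₅_mem [IsUltrametricDist F] (i j : Fin 5) : J₅ F i j ∈ R F := by
  fin_cases i <;> fin_cases j <;> simp [J₅, zero_mem, one_mem]

theorem norm_mulVec [IsUltrametricDist F] {k : Matrix (Fin 5) (Fin 5) F} (hk : k ∈ K F) (v : Fin 5 → F) :
    ‖k *ᵥ v‖ = ‖v‖ := by
  refine le_antisymm (norm_mulVec_le hk.2 v) ?_
  have hinv : J₅ F * kᵀ * J₅ F * k = 1 := by
    rw [Matrix.mul_assoc, Matrix.mul_assoc, ← Matrix.mul_assoc kᵀ, hk.1.2, J₅_mul_self]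
  have h := norm_mulVec_le (g := J₅ F * kᵀ * J₅ F)
    (mul_entries_mem (mul_entries_mem J₅_mem fun i j => hk.2 j i) J₅_mem) (k *ᵥ v)
  rwa [Matrix.mulVec_mulVec, hinv, Matrix.one_mulVec] at h

theorem mul_mem_K [IsUltrametricDist F] {g h : Matrix (Fin 5) (Fin 5) F} (hg : g ∈ K F) (hh : h ∈ K F) :
    g * h ∈ K F := by
  refine ⟨⟨by rw [Matrix.det_mul, hg.1.1, hh.1.1, one_mul], ?_⟩, mul_entries_mem hg.2 hh.2⟩
  calc (g * h)ᵀ * J₅ F * (g * h) = hᵀ * (gᵀ * J₅ F * g) * h := by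
        simp only [Matrix.transpose_mul, Matrix.mul_assoc]
    _ = J₅ F := by rw [hg.1.2, hh.1.2]

theorem n_mem_G (h2 : (2 : F) ≠ 0) (x y z : F) : n x y z ∈ G F := by
  constructor
  · rw [n, Matrix.det_of_isUpperTriangular]
    · simp [Fin.prod_univ_five]
    · intro i j hij
      fin_cases i <;> fin_cases j <;> first | rfl | (exact absurd hij (by decide))
  · ext i j
    fin_cases i <;> fin_cases j <;>
      simp [n, J₅, Matrix.mul_apply, Fin.sum_univ_five]
    field_simp
    ring

theorem n_mem_K [IsUltrametricDist F] (h2 : ‖(2 : F)‖ = 1) {x y z : F} (hx : ‖x‖ ≤ 1) (hy : ‖y‖ ≤ 1) (hz : ‖z‖ ≤ 1) :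
    n x y z ∈ K F := by
  have h20 : (2 : F) ≠ 0 := norm_ne_zero_iff.1 (by rw [h2]; exact one_ne_zero)
  refine ⟨n_mem_G h20 x y z, ?_⟩
  have hx := mem_R_iff.2 hx
  have hy := mem_R_iff.2 hy
  have hz := mem_R_iff.2 hz
  have h2' : (2 : F)⁻¹ ∈ R F := mem_R_iff.2 (by rw [norm_inv, h2, inv_one])
  have hc : -x * z - y ^ 2 / 2 ∈ R F :=
    sub_mem (mul_mem (neg_mem hx) hz) (by rw [div_eq_mul_inv]; exact mul_mem (pow_mem hy 2) h2')
  intro i j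
  fin_cases i <;> fin_cases j <;>
    first | exact one_mem _ | exact zero_mem _ | assumption | exact neg_mem ‹_›

theorem a_mem_G (α : Fˣ) : a α ∈ G F := by
  have := α.ne_zero
  constructor
  · rw [a, Matrix.det_diagonal]
    simp [Fin.prod_univ_five]
  · ext i j
    fin_cases i <;> fin_cases j <;>
      simp [a, J₅, Matrix.mul_apply, Matrix.diagonal_apply]

theorem a_mem_K [IsUltrametricDist F] {u : Fˣ} (hu : ‖(u : F)‖ = 1) : a u ∈ K F := by
  refine ⟨a_mem_G u, fun i j => ?_⟩
  have h1 : (u : F) ∈ R F := mem_R_iff.2 hu.le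
  have h2 : (u : F)⁻¹ ∈ R F := mem_R_iff.2 (by rw [norm_inv, hu, inv_one])
  rw [a, Matrix.diagonal_apply]
  split_ifs
  · fin_cases i <;> first | exact one_mem _ | assumption
  · exact zero_mem _

/-- The Weyl element exchanging the first and the last coordinate. -/
def weylOuter (F : Type*) [NontriviallyNormedField F] : Matrix (Fin 5) (Fin 5) F :=
  !![0, 0, 0, 0, 1;
     0, 1, 0, 0, 0;
     0, 0, -1, 0, 0;
     0, 0, 0, 1, 0;
     1, 0, 0, 0, 0]

/-- The Weyl element exchanging the first two and the last two coordinates. -/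
def weylInner (F : Type*) [NontriviallyNormedField F] : Matrix (Fin 5) (Fin 5) F :=
  !![0, 1, 0, 0, 0;
     1, 0, 0, 0, 0;
     0, 0, 1, 0, 0;
     0, 0, 0, 0, 1;
     0, 0, 0, 1, 0]

theorem weylOuter_mem_K [IsUltrametricDist F] : weylOuter F ∈ K F := by
  refine ⟨⟨?_, ?_⟩, fun i j => ?_⟩
  · simp [weylOuter, Matrix.det_succ_row_zero, Fin.sum_univ_succ, Fin.succAbove]
    ring
  · ext i j
    fin_cases i <;> fin_cases j <;>
      simp [weylOuter, J₅, Matrix.mul_apply, Fin.sum_univ_five]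
  · fin_cases i <;> fin_cases j <;>
      first | exact one_mem _ | exact zero_mem _ | exact neg_mem (one_mem _)

theorem weylInner_mem_K [IsUltrametricDist F] : weylInner F ∈ K F := by
  refine ⟨⟨?_, ?_⟩, fun i j => ?_⟩
  · simp [weylInner, Matrix.det_succ_row_zero, Fin.sum_univ_succ, Fin.succAbove]
  · ext i j
    fin_cases i <;> fin_cases j <;>
      simp [weylInner, J₅, Matrix.mul_apply, Fin.sum_univ_five]
  · fin_cases i <;> fin_cases j <;>
      first | exact one_mem _ | exact zero_mem _

theorem weylOuter_mulVec (v : Fin 5 → F) : weylOuter F *ᵥ v = ![v 4, v 1, -v 2, v 3, v 0] := by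
  ext i
  fin_cases i <;> simp [weylOuter, Matrix.mulVec, dotProduct, Fin.sum_univ_five]

theorem weylInner_mulVec (v : Fin 5 → F) : weylInner F *ᵥ v = ![v 1, v 0, v 2, v 4, v 3] := by
  ext i
  fin_cases i <;> simp [weylInner, Matrix.mulVec, dotProduct, Fin.sum_univ_five]

theorem n_mulVec (x y z : F) (v : Fin 5 → F) :
    n x y z *ᵥ v = ![v 0 - z * v 1 - y * v 2 - x * v 3 + (-x * z - y ^ 2 / 2) * v 4,
      v 1 + x * v 4, v 2 + y * v 4, v 3 + z * v 4, v 4] := by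
  ext i
  fin_cases i <;> simp [n, Matrix.mulVec, dotProduct, Fin.sum_univ_five]
  ring

theorem n_neg_mul_n (h2 : (2 : F) ≠ 0) (y : F) : n 0 (-y) 0 * n 0 y 0 = 1 := by
  ext i j
  fin_cases i <;> fin_cases j <;>
    simp [n, Matrix.mul_apply, Fin.sum_univ_five]
  field_simp
  ring

theorem a_mulVec_v₁ (α : Fˣ) : a α *ᵥ v₁ F = ![(α : F) / 2, 0, 0, 0, (α : F)⁻¹] := by
  ext i
  fin_cases i <;> simp [a, v₁, Matrix.mulVec_diagonal, div_eq_mul_inv]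

theorem n_mulVec_a_mulVec_v₁ (α : Fˣ) (x y z : F) :
    n x y z *ᵥ (a α *ᵥ v₁ F) = ![(α : F) / 2 - (α : F)⁻¹ * (x * z + y ^ 2 / 2),
      (α : F)⁻¹ * x, (α : F)⁻¹ * y, (α : F)⁻¹ * z, (α : F)⁻¹] := by
  rw [a_mulVec_v₁, n_mulVec]
  ext i
  fin_cases i <;> simp <;> ring

theorem v₁_mem_S (h2 : (2 : F) ≠ 0) : v₁ F ∈ S F := by
  rw [mem_S_iff]
  simp [v₁, h2]

theorem γ₀_mulVec_v₀ : γ₀ F *ᵥ v₀ F = v₁ F := by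
  ext i
  fin_cases i <;> simp [γ₀, v₀, v₁, Matrix.mulVec, dotProduct, Fin.sum_univ_five]

theorem mulVec_mem_orbit [IsUltrametricDist F] {ϖ : Fˣ} {i : ℕ} {k : Matrix (Fin 5) (Fin 5) F} (hk : k ∈ K F)
    {v : Fin 5 → F} (hv : v ∈ orbit ϖ i) : k *ᵥ v ∈ orbit ϖ i := by
  obtain ⟨k', hk', rfl⟩ := hv
  exact ⟨k * k', mul_mem_K hk hk', by rw [Matrix.mulVec_mulVec]⟩

variable {ϖ : Fˣ}

/-- A point of `S` whose last coordinate is dominant lies in one of the orbits. -/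
theorem mem_orbit_of_norm_last [IsUltrametricDist F] (h2 : ‖(2 : F)‖ = 1) {i : ℕ} {v : Fin 5 → F} (hv : v ∈ S F)
    (hle : ∀ j, ‖v j‖ ≤ ‖v 4‖) (h4 : ‖v 4‖ = ‖(ϖ : F)‖⁻¹ ^ i) : v ∈ orbit ϖ i := by
  have h20 : (2 : F) ≠ 0 := norm_ne_zero_iff.1 (by rw [h2]; exact one_ne_zero)
  have hv4 : v 4 ≠ 0 := by
    refine norm_ne_zero_iff.1 ?_
    rw [h4]
    exact pow_ne_zero _ (inv_ne_zero (norm_ne_zero_iff.2 ϖ.ne_zero))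
  have hϖ0 := ϖ.ne_zero
  have hx : ∀ j, ‖(v 4)⁻¹ * v j‖ ≤ 1 := fun j => by
    rw [norm_mul, norm_inv, inv_mul_le_iff₀ (norm_pos_iff.2 hv4), mul_one]
    exact hle j
  let u : Fˣ := (Units.mk0 (v 4) hv4)⁻¹ * (ϖ ^ i)⁻¹
  have hu : ‖(u : F)‖ = 1 := by
    simp only [u, Units.val_mul, Units.val_inv_eq_inv_val, Units.val_mk0, Units.val_pow_eq_pow_val,
      norm_mul, norm_inv, norm_pow, h4, inv_pow, inv_inv]
    exact mul_inv_cancel₀ (pow_ne_zero _ (norm_ne_zero_iff.2 hϖ0))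
  refine ⟨n ((v 4)⁻¹ * v 1) ((v 4)⁻¹ * v 2) ((v 4)⁻¹ * v 3) * a u,
    mul_mem_K (n_mem_K h2 (hx 1) (hx 2) (hx 3)) (a_mem_K hu), ?_⟩
  have ha : a u *ᵥ (a (ϖ ^ i) *ᵥ v₁ F) = a (Units.mk0 (v 4) hv4)⁻¹ *ᵥ v₁ F := by
    rw [a_mulVec_v₁, a_mulVec_v₁]
    ext j
    fin_cases j <;> simp [a, Matrix.mulVec_diagonal, u] <;> field_simp
  rw [← Matrix.mulVec_mulVec, ha, n_mulVec_a_mulVec_v₁]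
  rw [mem_S_iff] at hv
  ext j
  fin_cases j
  · simp
    field_simp
    linear_combination hv
  all_goals simp [hv4]

end Orbits

section OrbitsDescription

variable {F : Type*} [NontriviallyNormedField F]

theorem weylOuter_mul_self : weylOuter F * weylOuter F = 1 := by
  ext i j
  fin_cases i <;> fin_cases j <;> simp [weylOuter, Matrix.mul_apply, Fin.sum_univ_five]

theorem weylInner_mul_self : weylInner F * weylInner F = 1 := by
  ext i j
  fin_cases i <;> fin_cases j <;> simp [weylInner, Matrix.mul_apply, Fin.sum_univ_five]

variable [IsUltrametricDist F] {ϖ : Fˣ}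

theorem mem_orbit_of_mulVec_mem {g k : Matrix (Fin 5) (Fin 5) F} (hg : g ∈ K F)
    {v : Fin 5 → F} (hgk : g * k = 1) {i : ℕ} (hv : k *ᵥ v ∈ orbit ϖ i) : v ∈ orbit ϖ i := by
  have := mulVec_mem_orbit hg hv
  rwa [Matrix.mulVec_mulVec, hgk, Matrix.one_mulVec] at this

/-- A point of `S` of norm `q ^ i` lies in the `i`-th orbit. -/
theorem mem_orbit_of_norm_eq (h2 : ‖(2 : F)‖ = 1) (hϖ1 : ‖(ϖ : F)‖ < 1) {i : ℕ} {v : Fin 5 → F}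
    (hv : v ∈ S F) (hnorm : ‖v‖ = ‖(ϖ : F)‖⁻¹ ^ i) : v ∈ orbit ϖ i := by
  have h20 : (2 : F) ≠ 0 := norm_ne_zero_iff.1 (by rw [h2]; exact one_ne_zero)
  have last : ∀ w : Fin 5 → F, w ∈ S F → ‖w‖ = ‖(ϖ : F)‖⁻¹ ^ i → ‖w 4‖ = ‖w‖ → w ∈ orbit ϖ i :=
    fun w hw hn h => mem_orbit_of_norm_last h2 hw (fun j => h ▸ norm_le_pi_norm w j) (h.trans hn)
  have first : ∀ w : Fin 5 → F, w ∈ S F → ‖w‖ = ‖(ϖ : F)‖⁻¹ ^ i → ‖w 0‖ = ‖w‖ →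
      w ∈ orbit ϖ i := fun w hw hn h =>
    mem_orbit_of_mulVec_mem weylOuter_mem_K weylOuter_mul_self <|
      last _ ((mulVec_mem_S weylOuter_mem_K.1).2 hw) ((norm_mulVec weylOuter_mem_K w).trans hn)
        (by rw [norm_mulVec weylOuter_mem_K, weylOuter_mulVec]; exact h)
  by_cases h0 : ‖v 0‖ = ‖v‖
  · exact first v hv hnorm h0
  by_cases h4 : ‖v 4‖ = ‖v‖
  · exact last v hv hnorm h4
  have hSI := (mulVec_mem_S weylInner_mem_K.1).2 hv
  have hNI := (norm_mulVec weylInner_mem_K v).trans hnorm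
  by_cases h1 : ‖v 1‖ = ‖v‖
  · refine mem_orbit_of_mulVec_mem weylInner_mem_K weylInner_mul_self (first _ hSI hNI ?_)
    rw [norm_mulVec weylInner_mem_K, weylInner_mulVec]; exact h1
  by_cases h3 : ‖v 3‖ = ‖v‖
  · refine mem_orbit_of_mulVec_mem weylInner_mem_K weylInner_mul_self (last _ hSI hNI ?_)
    rw [norm_mulVec weylInner_mem_K, weylInner_mulVec]; exact h3
  have lt : ∀ j, ‖v j‖ ≠ ‖v‖ → ‖v j‖ < ‖v‖ := fun j hj => lt_of_le_of_ne (norm_le_pi_norm v j) hj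
  replace h0 := lt 0 h0
  replace h1 := lt 1 h1
  replace h3 := lt 3 h3
  replace h4 := lt 4 h4
  have hpos : 0 < ‖v‖ := (norm_nonneg _).trans_lt h0
  have hv2 : ‖v 2‖ = ‖v‖ := by
    refine le_antisymm (norm_le_pi_norm v 2) (not_lt.1 fun h => ?_)
    have := (pi_norm_lt_iff hpos).2 fun j => show ‖v j‖ < ‖v‖ by fin_cases j <;> assumption
    exact lt_irrefl _ this
  have one_le : 1 ≤ ‖v‖ := by
    rw [hnorm]
    exact one_le_pow₀ ((one_le_inv₀ (norm_pos_iff.2 ϖ.ne_zero)).2 hϖ1.le)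
  have hnorm1 : ‖v‖ = 1 := by
    refine le_antisymm (not_lt.1 fun hlt => ?_) one_le
    have hS : v 2 ^ 2 = (1 + -(2 * v 0 * v 4)) + -(2 * v 1 * v 3) := by
      rw [mem_S_iff] at hv
      linear_combination hv
    have hsq : ‖v 2 ^ 2‖ = ‖v‖ * ‖v‖ := by rw [norm_pow, hv2, sq]
    have h04 : ‖-(2 * v 0 * v 4)‖ < ‖v‖ * ‖v‖ := by
      rw [norm_neg, norm_mul, norm_mul, h2, one_mul]
      exact mul_lt_mul'' h0 h4 (norm_nonneg _) (norm_nonneg _)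
    have h13 : ‖-(2 * v 1 * v 3)‖ < ‖v‖ * ‖v‖ := by
      rw [norm_neg, norm_mul, norm_mul, h2, one_mul]
      exact mul_lt_mul'' h1 h3 (norm_nonneg _) (norm_nonneg _)
    have hone : ‖(1 : F)‖ < ‖v‖ * ‖v‖ := by
      rw [norm_one]
      exact one_lt_mul_of_le_of_lt one_le hlt
    refine lt_irrefl (‖v‖ * ‖v‖) ?_
    conv_lhs => rw [← hsq, hS]
    exact (IsUltrametricDist.norm_add_le_max _ _).trans_lt
      (max_lt ((IsUltrametricDist.norm_add_le_max _ _).trans_lt (max_lt hone h04)) h13)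
  have hK : ∀ y : F, ‖y‖ = 1 → n 0 y 0 ∈ K F := fun y hy =>
    n_mem_K h2 (by simp) hy.le (by simp)
  have hK1 := hK 1 norm_one
  refine mem_orbit_of_mulVec_mem (hK (-1) (by simp)) (n_neg_mul_n h20 1)
    (first _ ((mulVec_mem_S hK1.1).2 hv) ((norm_mulVec hK1 v).trans hnorm) ?_)
  rw [norm_mulVec hK1, n_mulVec]
  have hexp : v 0 - 0 * v 1 - 1 * v 2 - 0 * v 3 + (-0 * 0 - 1 ^ 2 / 2) * v 4
      = (v 0 + -(2⁻¹ * v 4)) + -v 2 := by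
    field_simp
    ring
  have hlt : ‖v 0 + -(2⁻¹ * v 4)‖ < ‖-v 2‖ := by
    rw [norm_neg, hv2]
    refine (IsUltrametricDist.norm_add_le_max _ _).trans_lt (max_lt h0 ?_)
    rwa [norm_neg, norm_mul, norm_inv, h2, inv_one, one_mul]
  change ‖v 0 - 0 * v 1 - 1 * v 2 - 0 * v 3 + (-0 * 0 - 1 ^ 2 / 2) * v 4‖ = ‖v‖
  rw [hexp, IsUltrametricDist.norm_add_eq_max_of_norm_ne_norm hlt.ne, max_eq_right hlt.le,
    norm_neg, hv2]

theorem mem_orbit_iff (h2 : ‖(2 : F)‖ = 1) (hϖ1 : ‖(ϖ : F)‖ < 1) {i : ℕ} {v : Fin 5 → F} :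
    v ∈ orbit ϖ i ↔ v ∈ S F ∧ ‖v‖ = ‖(ϖ : F)‖⁻¹ ^ i := by
  refine ⟨?_, fun h => mem_orbit_of_norm_eq h2 hϖ1 h.1 h.2⟩
  rintro ⟨k, hk, rfl⟩
  have h20 : (2 : F) ≠ 0 := norm_ne_zero_iff.1 (by rw [h2]; exact one_ne_zero)
  refine ⟨(mulVec_mem_S hk.1).2 ((mulVec_mem_S (a_mem_G _)).2 (v₁_mem_S h20)), ?_⟩
  have hpos : 0 < ‖(ϖ : F)‖ := norm_pos_iff.2 ϖ.ne_zero
  rw [norm_mulVec hk, a_mulVec_v₁]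
  have h4 : ‖((ϖ ^ i : Fˣ) : F)⁻¹‖ = ‖(ϖ : F)‖⁻¹ ^ i := by
    rw [norm_inv, Units.val_pow_eq_pow_val, norm_pow, inv_pow]
  have hge : 0 ≤ ‖(ϖ : F)‖⁻¹ ^ i := by positivity
  refine le_antisymm ((pi_norm_le_iff_of_nonneg hge).2 fun j => ?_) ?_
  · have h0 : ‖((ϖ ^ i : Fˣ) : F) / 2‖ ≤ ‖(ϖ : F)‖⁻¹ ^ i := by
      rw [norm_div, h2, div_one, Units.val_pow_eq_pow_val, norm_pow]
      exact pow_le_pow_left₀ hpos.le (hϖ1.le.trans ((one_le_inv₀ hpos).2 hϖ1.le)) _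
    fin_cases j
    · exact h0
    iterate 3 exact norm_zero.le.trans hge
    · exact h4.le
  · rw [← h4]
    exact norm_le_pi_norm ![((ϖ ^ i : Fˣ) : F) / 2, 0, 0, 0, ((ϖ ^ i : Fˣ) : F)⁻¹] 4

/-- The points of `S` have norm at least one. -/
theorem one_le_norm_of_mem_S {v : Fin 5 → F} (hv : v ∈ S F) : 1 ≤ ‖v‖ := by
  refine not_lt.1 fun h => ?_
  have hj : ∀ j, ‖v j‖ < 1 := fun j => (norm_le_pi_norm v j).trans_lt h
  have h2 : ‖(2 : F)‖ ≤ 1 := by simpa using IsUltrametricDist.norm_natCast_le_one F 2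
  have hprod : ∀ i j, ‖2 * v i * v j‖ < 1 := fun i j => by
    rw [norm_mul, norm_mul]
    exact mul_lt_one_of_nonneg_of_lt_one_right
      (mul_le_one₀ h2 (norm_nonneg _) (hj i).le) (norm_nonneg _) (hj j)
  have hsq : ‖v 2 ^ 2‖ < 1 := by
    rw [norm_pow]
    exact pow_lt_one₀ (norm_nonneg _) (hj 2) two_ne_zero
  have h1 : ‖(1 : F)‖ < 1 := by
    rw [← mem_S_iff.1 hv]
    exact (IsUltrametricDist.norm_add_le_max _ _).trans_lt
      (max_lt ((IsUltrametricDist.norm_add_le_max _ _).trans_lt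
        (max_lt (hprod 0 4) (hprod 1 3))) hsq)
  rw [norm_one] at h1
  exact lt_irrefl _ h1

theorem IsUniformizer.exists_norm_eq_pow (hϖ : IsUniformizer ϖ)
    (h_norm : ‖(ϖ : F)‖ = (q F : ℝ)⁻¹) {v : Fin 5 → F} (hv : 1 ≤ ‖v‖) :
    ∃ i : ℕ, ‖v‖ = (q F : ℝ) ^ i := by
  obtain ⟨j, hj⟩ : ∃ j, ‖v j‖ = ‖v‖ := by
    obtain ⟨j, hj⟩ := Finite.exists_max fun j => ‖v j‖
    exact ⟨j, le_antisymm (norm_le_pi_norm v j)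
      ((pi_norm_le_iff_of_nonneg (norm_nonneg _)).2 hj)⟩
  have hj0 : v j ≠ 0 := norm_pos_iff.1 (by rw [hj]; exact zero_lt_one.trans_le hv)
  obtain ⟨k, hk⟩ := hϖ.exists_norm_eq_zpow h_norm hj0
  rw [hj] at hk
  have hk0 : 0 ≤ k := by
    rw [hk] at hv
    exact (one_le_zpow_iff_right₀ (hϖ.one_lt_q h_norm)).1 hv
  lift k to ℕ using hk0
  exact ⟨k, by rw [hk, zpow_natCast]⟩

theorem Φ_eq_indicator (h2 : ‖(2 : F)‖ = 1) (hϖ : IsUniformizer ϖ)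
    (h_norm : ‖(ϖ : F)‖ = (q F : ℝ)⁻¹) (r : ℕ) :
    Φ ϖ r = {v : Fin 5 → F | v ∈ S F ∧ ∀ i, ‖v i‖ ≤ (q F : ℝ) ^ r}.indicator
      (fun _ => (1 : ℂ)) := by
  have hq := hϖ.one_lt_q h_norm
  have hϖ1 : ‖(ϖ : F)‖ < 1 := hϖ.norm_lt_one_iff.2 le_rfl
  have horbit : ∀ i v, v ∈ orbit ϖ i ↔ v ∈ S F ∧ ‖v‖ = (q F : ℝ) ^ i := fun i v => by
    rw [mem_orbit_iff h2 hϖ1, h_norm, inv_inv]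
  funext v
  classical
  simp only [Φ, Set.indicator_apply, Set.mem_ofPred_eq, horbit]
  have hball : (∀ i, ‖v i‖ ≤ (q F : ℝ) ^ r) ↔ ‖v‖ ≤ (q F : ℝ) ^ r :=
    (pi_norm_le_iff_of_nonneg (by positivity)).symm
  simp only [hball]
  by_cases hv : v ∈ S F
  · obtain ⟨i, hi⟩ := hϖ.exists_norm_eq_pow h_norm (one_le_norm_of_mem_S hv)
    simp only [hv, true_and, hi, pow_right_inj₀ (zero_lt_one.trans hq) hq.ne',
      pow_le_pow_iff_right₀ hq, Finset.sum_ite_eq, Finset.mem_range, Nat.lt_succ_iff]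
  · simp [hv]

end OrbitsDescription

/-- A function which is multiplied by a constant other than one under some translation has
integral zero. -/
@[to_additive integral_eq_zero_of_add_eq_mul]
theorem integral_eq_zero_of_mul_eq_mul {E : Type*} [Group E] [MeasurableSpace E] [MeasurableMul E]
    (μ : Measure E) [μ.IsMulLeftInvariant] (f : E → ℂ) (t : E) {c : ℂ} (hc : c ≠ 1)
    (h : ∀ x, f (t * x) = c * f x) : ∫ x, f x ∂μ = 0 := by
  have h1 : ∫ x, f x ∂μ = c * ∫ x, f x ∂μ := by
    rw [← integral_const_mul, ← integral_mul_left_eq_self f t]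
    simp only [h]
  have h2 : (c - 1) * ∫ x, f x ∂μ = 0 := by rw [sub_mul, ← h1, one_mul, sub_self]
  exact (mul_eq_zero.1 h2).resolve_left (sub_ne_zero.2 hc)

section OrbitalIntegrals

variable {F : Type*} [NontriviallyNormedField F]

/-- The set of the `(x₁, x₂, x₃)` for which `n(x₁, x₂, x₃) a_α v₁` has norm at most `A / |α|`,
for `1 ≤ A`. -/
def orbitalSupport (α : F) (A : ℝ) : Set (F × F × F) :=
  {x | ‖x.1‖ ≤ A ∧ ‖x.2.1‖ ≤ A ∧ ‖x.2.2‖ ≤ A ∧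
    ‖α ^ 2 - 2 * x.1 * x.2.2 - x.2.1 ^ 2‖ ≤ A}

/-- The slice of `orbitalSupport` at a value of `x₁`, without the condition on `x₁`. -/
def orbitalSlice (α : F) (A : ℝ) (s : F) : Set (F × F) :=
  {p | ‖p.1‖ ≤ A ∧ ‖p.2‖ ≤ A ∧ ‖α ^ 2 - 2 * s * p.2 - p.1 ^ 2‖ ≤ A}

theorem isCompact_orbitalSupport [ProperSpace F] (α : F) (A : ℝ) :
    IsCompact (orbitalSupport α A) := by
  refine (isCompact_closedBall (0 : F × F × F) A).of_isClosed_subset ?_ fun x hx => ?_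
  · simp only [orbitalSupport, Set.ofPred_and]
    refine (isClosed_le (by fun_prop) (by fun_prop)).inter
      ((isClosed_le (by fun_prop) (by fun_prop)).inter
        ((isClosed_le (by fun_prop) (by fun_prop)).inter
          (isClosed_le (by fun_prop) (by fun_prop))))
  · rw [mem_closedBall_zero_iff]
    exact max_le hx.1 (max_le hx.2.1 hx.2.2.1)

theorem isCompact_orbitalSlice [ProperSpace F] (α : F) (A : ℝ) (s : F) :
    IsCompact (orbitalSlice α A s) := by
  refine (isCompact_closedBall (0 : F × F) A).of_isClosed_subset ?_ fun x hx => ?_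
  · simp only [orbitalSlice, Set.ofPred_and]
    refine (isClosed_le (by fun_prop) (by fun_prop)).inter
        ((isClosed_le (by fun_prop) (by fun_prop)).inter
          (isClosed_le (by fun_prop) (by fun_prop)))
  · rw [mem_closedBall_zero_iff]
    exact max_le hx.1 hx.2.1

theorem integrable_indicator_of_isCompact {E : Type*} [TopologicalSpace E] [T2Space E]
    [MeasurableSpace E] [OpensMeasurableSpace E] {μ : Measure E}
    [IsFiniteMeasureOnCompacts μ] {s : Set E} (hs : IsCompact s) {f : E → ℂ} (hf : Continuous f) :
    Integrable (s.indicator f) μ :=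
  (integrable_indicator_iff hs.measurableSet).2 (hf.continuousOn.integrableOn_compact hs)

theorem orbitalIntegrand_indicator (h2 : ‖(2 : F)‖ = 1) (ψ : AddChar F Circle) {B : ℝ} (α : Fˣ) :
    orbitalIntegrand ψ ({v : Fin 5 → F | v ∈ S F ∧ ∀ i, ‖v i‖ ≤ B}.indicator fun _ => (1 : ℂ)) α =
      if 1 ≤ B * ‖(α : F)‖ then
        (orbitalSupport (α : F) (B * ‖(α : F)‖)).indicator fun x => (ψ x.2.1 : ℂ)
      else 0 := by
  have h20 : (2 : F) ≠ 0 := norm_ne_zero_iff.1 (by rw [h2]; exact one_ne_zero)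
  have hα : 0 < ‖(α : F)‖ := norm_pos_iff.2 α.ne_zero
  have hα0 := α.ne_zero
  funext x
  have hS : n x.1 x.2.1 x.2.2 *ᵥ (a α *ᵥ v₁ F) ∈ S F :=
    (mulVec_mem_S (n_mem_G h20 _ _ _)).2 ((mulVec_mem_S (a_mem_G _)).2 (v₁_mem_S h20))
  have hcoord : ∀ y : F, ‖(α : F)⁻¹ * y‖ ≤ B ↔ ‖y‖ ≤ B * ‖(α : F)‖ := fun y => by
    rw [norm_mul, norm_inv, inv_mul_le_iff₀ hα, mul_comm]
  have hfirst : (α : F) / 2 - (α : F)⁻¹ * (x.1 * x.2.2 + x.2.1 ^ 2 / 2)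
      = (α : F)⁻¹ * (2⁻¹ * ((α : F) ^ 2 - 2 * x.1 * x.2.2 - x.2.1 ^ 2)) := by
    field_simp
    ring
  have hmem : (n x.1 x.2.1 x.2.2 *ᵥ (a α *ᵥ v₁ F) ∈
      {v : Fin 5 → F | v ∈ S F ∧ ∀ i, ‖v i‖ ≤ B}) ↔
      1 ≤ B * ‖(α : F)‖ ∧ x ∈ orbitalSupport (α : F) (B * ‖(α : F)‖) := by
    rw [Set.mem_ofPred_eq, and_iff_right hS, n_mulVec_a_mulVec_v₁, hfirst]
    have e4 := hcoord 1
    rw [mul_one, norm_one] at e4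
    have e0 := hcoord (2⁻¹ * ((α : F) ^ 2 - 2 * x.1 * x.2.2 - x.2.1 ^ 2))
    rw [norm_mul 2⁻¹, norm_inv, h2, inv_one, one_mul] at e0
    rw [← e4, orbitalSupport, Set.mem_ofPred_eq, ← e0, ← hcoord, ← hcoord, ← hcoord]
    constructor
    · intro h
      exact ⟨h 4, h 1, h 2, h 3, h 0⟩
    · rintro ⟨h4, h1, h2, h3, h0⟩ i
      fin_cases i <;> assumption
  rw [orbitalIntegrand, γ₀_mulVec_v₀]
  classical
  rw [Set.indicator_apply]
  by_cases h1 : 1 ≤ B * ‖(α : F)‖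
  · simp only [hmem, h1, true_and, if_true, Set.indicator_apply]
    split_ifs <;> simp
  · rw [if_neg (fun h => h1 (hmem.1 h).1), zero_mul, if_neg h1, Pi.zero_apply]

theorem orbitalSupport_indicator_apply (α : F) (A : ℝ) (f : F → ℂ) (s : F) (p : F × F) :
    (orbitalSupport α A).indicator (fun x => f x.2.1) (s, p) =
      {s : F | ‖s‖ ≤ A}.indicator
        (fun s => (orbitalSlice α A s).indicator (fun p => f p.1) p) s := by
  classical
  simp only [Set.indicator_apply, orbitalSupport, orbitalSlice, Set.mem_ofPred_eq]
  split_ifs <;> tauto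

theorem norm_lt_of_mem_orbitalSlice [IsUltrametricDist F] (h2 : ‖(2 : F)‖ = 1) {α s : F} {A : ℝ} (hA : 1 < A)
    (hα : ‖α‖ < A) (hs : ‖s‖ < A) {p : F × F} (hp : p ∈ orbitalSlice α A s) : ‖p.1‖ < A := by
  have hA0 : 0 < A := zero_lt_one.trans hA
  have heq : p.1 ^ 2 = (α ^ 2 + -(2 * s * p.2)) + -(α ^ 2 - 2 * s * p.2 - p.1 ^ 2) := by ring
  have hsq : ‖p.1‖ ^ 2 < A ^ 2 := by
    rw [← norm_pow, heq]
    refine (IsUltrametricDist.norm_add_le_max _ _).trans_lt (max_lt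
      ((IsUltrametricDist.norm_add_le_max _ _).trans_lt (max_lt ?_ ?_)) ?_)
    · rw [norm_pow]
      exact pow_lt_pow_left₀ hα (norm_nonneg _) two_ne_zero
    · rw [norm_neg, norm_mul, norm_mul, h2, one_mul, sq]
      exact (mul_le_mul_of_nonneg_left hp.2.1 (norm_nonneg _)).trans_lt
        (mul_lt_mul_of_pos_right hs hA0)
    · rw [norm_neg]
      exact hp.2.2.trans_lt (by nlinarith)
  exact lt_of_pow_lt_pow_left₀ 2 hA0.le hsq

variable [IsUltrametricDist F] [ProperSpace F] [MeasurableSpace F] [BorelSpace F]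

theorem integral_orbitalSupport (μ : Measure F) [μ.IsAddHaarMeasure] (α : F) (A : ℝ)
    {f : F → ℂ} (hf : Continuous f) :
    ∫ x, (orbitalSupport α A).indicator (fun x => f x.2.1) x ∂(μ.prod (μ.prod μ)) =
      ∫ s in {s : F | ‖s‖ ≤ A},
        ∫ p, (orbitalSlice α A s).indicator (fun p => f p.1) p ∂(μ.prod μ) ∂μ := by
  have hint : Integrable ((orbitalSupport α A).indicator fun x => f x.2.1)
      (μ.prod (μ.prod μ)) :=
    integrable_indicator_of_isCompact (isCompact_orbitalSupport α A) (by fun_prop)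
  rw [integral_prod _ hint, ← integral_indicator
    (isClosed_le continuous_norm continuous_const).measurableSet]
  refine integral_congr_ae (.of_forall fun s => ?_)
  simp only [orbitalSupport_indicator_apply]
  by_cases hs : s ∈ {s : F | ‖s‖ ≤ A}
  · simp only [Set.indicator_of_mem hs]
  · simp only [Set.indicator_of_notMem hs, integral_zero]

/-- On the outer shell, integrating over `x₃` first leaves the integral of `ψ` over a ball. -/
theorem integral_orbitalSlice_eq_zero_of_norm_eq (h2 : ‖(2 : F)‖ = 1)
    (μ : Measure F) [μ.IsAddHaarMeasure] (hμ : μ {x : F | ‖x‖ ≤ 1} = 1)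
    {ψ : AddChar F Circle} (hψ : Continuous ψ) {t : F} (ht : ψ t ≠ 1)
    {α s : F} {A : ℝ} (hA : 1 ≤ A) (htA : ‖t‖ ≤ A) (hα : ‖α‖ ≤ A) (hs : ‖s‖ = A) :
    ∫ p, (orbitalSlice α A s).indicator (fun p => (ψ p.1 : ℂ)) p ∂(μ.prod μ) = 0 := by
  have hA0 : 0 < A := zero_lt_one.trans_le hA
  have hs0 : s ≠ 0 := norm_pos_iff.1 (hs ▸ hA0)
  have h20 : (2 : F) ≠ 0 := norm_ne_zero_iff.1 (by rw [h2]; exact one_ne_zero)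
  have hint : Integrable ((orbitalSlice α A s).indicator fun p => (ψ p.1 : ℂ)) (μ.prod μ) :=
    integrable_indicator_of_isCompact (isCompact_orbitalSlice α A s) (by fun_prop)
  have hslice : ∀ y z : F, (y, z) ∈ orbitalSlice α A s ↔
      ‖y‖ ≤ A ∧ ‖-((α ^ 2 - y ^ 2) / (2 * s)) + z‖ ≤ 1 := by
    intro y z
    have hfac : α ^ 2 - 2 * s * z - y ^ 2 = -(2 * s * (-((α ^ 2 - y ^ 2) / (2 * s)) + z)) := by
      field_simp
      ring
    have hiff : ‖α ^ 2 - 2 * s * z - y ^ 2‖ ≤ A ↔ ‖-((α ^ 2 - y ^ 2) / (2 * s)) + z‖ ≤ 1 := by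
      rw [hfac, norm_neg, norm_mul, norm_mul, h2, one_mul, hs, mul_le_iff_le_one_right hA0]
    simp only [orbitalSlice, Set.mem_ofPred_eq, hiff]
    refine ⟨fun h => ⟨h.1, h.2.2⟩, fun h => ⟨h.1, ?_, h.2⟩⟩
    have hc : ‖(α ^ 2 - y ^ 2) / (2 * s)‖ ≤ A := by
      rw [norm_div, norm_mul, h2, one_mul, hs, div_le_iff₀ hA0, sub_eq_add_neg]
      refine (IsUltrametricDist.norm_add_le_max _ _).trans (max_le ?_ ?_)
      · rw [norm_pow, sq]
        exact mul_le_mul hα hα (norm_nonneg _) hA0.le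
      · rw [norm_neg, norm_pow, sq]
        exact mul_le_mul h.1 h.1 (norm_nonneg _) hA0.le
    have hz := IsUltrametricDist.norm_add_le_max
      ((α ^ 2 - y ^ 2) / (2 * s)) (-((α ^ 2 - y ^ 2) / (2 * s)) + z)
    rw [add_neg_cancel_left] at hz
    exact hz.trans (max_le hc (h.2.trans hA))
  rw [integral_prod _ hint]
  have hinner : ∀ y : F, ∫ z, (orbitalSlice α A s).indicator (fun p => (ψ p.1 : ℂ)) (y, z) ∂μ =
      {y : F | ‖y‖ ≤ A}.indicator (fun y => (ψ y : ℂ)) y := by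
    intro y
    by_cases hy : ‖y‖ ≤ A
    · have hball : ∀ z, (orbitalSlice α A s).indicator (fun p => (ψ p.1 : ℂ)) (y, z) =
          {z : F | ‖z‖ ≤ 1}.indicator (fun _ => (ψ y : ℂ))
            (-((α ^ 2 - y ^ 2) / (2 * s)) + z) := by
        intro z
        classical
        simp only [Set.indicator_apply, hslice, hy, true_and, Set.mem_ofPred_eq]
      simp only [hball]
      rw [integral_add_left_eq_self
        (fun z => {z : F | ‖z‖ ≤ 1}.indicator (fun _ => (ψ y : ℂ)) z),
        integral_indicator_const _ (isClosed_le continuous_norm continuous_const).measurableSet,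
        Measure.real, hμ, ENNReal.toReal_one, one_smul]
      exact (Set.indicator_of_mem (s := {y : F | ‖y‖ ≤ A}) hy fun y => (ψ y : ℂ)).symm
    · simp [hslice, hy]
  simp only [hinner]
  refine integral_eq_zero_of_add_eq_mul μ _ t (c := (ψ t : ℂ)) (by simpa [Circle.coe_eq_one] using ht) fun y => ?_
  have hball : ‖t + y‖ ≤ A ↔ ‖y‖ ≤ A := by
    constructor <;> intro h
    · have := IsUltrametricDist.norm_add_le_max (-t) (t + y)
      rw [neg_add_cancel_left, norm_neg] at this
      exact this.trans (max_le htA h)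
    · exact (IsUltrametricDist.norm_add_le_max _ _).trans (max_le htA h)
  classical
  simp only [Set.indicator_apply, Set.mem_ofPred_eq, hball, AddChar.map_add_eq_mul, Circle.coe_mul,
    mul_ite, mul_zero]

end OrbitalIntegrals

section OrbitalIntegralValues

variable {F : Type*} [NontriviallyNormedField F] [IsUltrametricDist F] {ϖ : Fˣ}

theorem add_mem_orbitalSlice (h2 : ‖(2 : F)‖ = 1) (hϖ : IsUniformizer ϖ)
    (h_norm : ‖(ϖ : F)‖ = (q F : ℝ)⁻¹) {α s t : F} {N : ℕ} (hN : 2 ≤ N)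
    (ht : ‖t‖ ≤ q F) (hα : ‖α‖ < (q F : ℝ) ^ N) (hs : ‖s‖ < (q F : ℝ) ^ N) {p : F × F}
    (hp : p ∈ orbitalSlice α ((q F : ℝ) ^ N) s) :
    (t, (0 : F)) + p ∈ orbitalSlice α ((q F : ℝ) ^ N) s := by
  have hq := hϖ.one_lt_q h_norm
  have hq0 := zero_lt_one.trans hq
  have hA : 1 < (q F : ℝ) ^ N := one_lt_pow₀ hq (by omega)
  have hqA : (q F : ℝ) ≤ (q F : ℝ) ^ N := le_self_pow₀ hq.le (by omega)
  have hp1 : (q F : ℝ) * ‖p.1‖ ≤ (q F : ℝ) ^ N := by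
    have h := norm_lt_of_mem_orbitalSlice h2 hA hα hs hp
    rw [← zpow_natCast] at h ⊢
    exact hϖ.mul_norm_le_of_norm_lt_zpow h_norm h
  refine ⟨(IsUltrametricDist.norm_add_le_max _ _).trans (max_le (ht.trans hqA) hp.1), ?_, ?_⟩
  · simpa using hp.2.1
  · have heq : α ^ 2 - 2 * s * ((t, (0 : F)) + p).2 - ((t, (0 : F)) + p).1 ^ 2 =
        (α ^ 2 - 2 * s * p.2 - p.1 ^ 2) + -(2 * t * p.1 + t ^ 2) := by
      simp only [Prod.snd_add, Prod.fst_add]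
      ring
    rw [heq]
    refine (IsUltrametricDist.norm_add_le_max _ _).trans (max_le hp.2.2 ?_)
    rw [norm_neg]
    refine (IsUltrametricDist.norm_add_le_max _ _).trans (max_le ?_ ?_)
    · rw [norm_mul, norm_mul, h2, one_mul]
      exact (mul_le_mul_of_nonneg_right ht (norm_nonneg _)).trans hp1
    · rw [norm_pow]
      exact (pow_le_pow_left₀ (norm_nonneg _) ht 2).trans (pow_le_pow_right₀ hq.le hN)

theorem mem_orbitalSlice_q_iff (h2 : ‖(2 : F)‖ = 1) (hϖ : IsUniformizer ϖ)
    (h_norm : ‖(ϖ : F)‖ = (q F : ℝ)⁻¹) {α s : F} (hα : ‖α‖ ≤ 1) (hs : ‖s‖ ≤ 1) {p : F × F} :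
    p ∈ orbitalSlice α (q F) s ↔ ‖p.1‖ ≤ 1 ∧ ‖p.2‖ ≤ q F := by
  have hq := hϖ.one_lt_q h_norm
  have hq0 := zero_lt_one.trans hq
  constructor
  · intro hp
    have h := norm_lt_of_mem_orbitalSlice h2 hq (hα.trans_lt hq) (hs.trans_lt hq) hp
    have h' := hϖ.mul_norm_le_of_norm_lt_zpow h_norm (k := 1) (by rwa [zpow_one])
    rw [zpow_one, mul_le_iff_le_one_right hq0] at h'
    exact ⟨h', hp.2.1⟩
  · rintro ⟨h1, h3⟩
    refine ⟨h1.trans hq.le, h3, ?_⟩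
    rw [sub_eq_add_neg, sub_eq_add_neg]
    refine (IsUltrametricDist.norm_add_le_max _ _).trans (max_le
      ((IsUltrametricDist.norm_add_le_max _ _).trans (max_le ?_ ?_)) ?_)
    · rw [norm_pow]
      exact (pow_le_one₀ (norm_nonneg _) hα).trans hq.le
    · rw [norm_neg, norm_mul, norm_mul, h2, one_mul]
      exact (mul_le_of_le_one_left (norm_nonneg _) hs).trans h3
    · rw [norm_neg, norm_pow]
      exact (pow_le_one₀ (norm_nonneg _) h1).trans hq.le

theorem HasConductorR.exists_norm_le (h_norm : ‖(ϖ : F)‖ = (q F : ℝ)⁻¹)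
    {ψ : AddChar F Circle} (hψ : HasConductorR ψ ϖ) : ∃ t : F, ‖t‖ ≤ q F ∧ ψ t ≠ 1 := by
  obtain ⟨x, hx, hne⟩ := hψ.2
  refine ⟨_, ?_, hne⟩
  rw [norm_mul, norm_inv, h_norm, inv_inv]
  exact mul_le_of_le_one_right (Nat.cast_nonneg _) (mem_R_iff.1 hx)

variable [ProperSpace F] [MeasurableSpace F] [BorelSpace F]

theorem integral_orbitalSupport_one (h2 : ‖(2 : F)‖ = 1) (μ : Measure F) [μ.IsAddHaarMeasure]
    (hμ : μ {x : F | ‖x‖ ≤ 1} = 1) {ψ : AddChar F Circle} (hψ : ∀ x ∈ R F, ψ x = 1)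
    {α : F} (hα : ‖α‖ ≤ 1) :
    ∫ x, (orbitalSupport α 1).indicator (fun x => (ψ x.2.1 : ℂ)) x ∂(μ.prod (μ.prod μ)) = 1 := by
  have hset : orbitalSupport α 1 =
      {x : F | ‖x‖ ≤ 1} ×ˢ ({x : F | ‖x‖ ≤ 1} ×ˢ {x : F | ‖x‖ ≤ 1}) := by
    ext x
    refine ⟨fun h => ⟨h.1, h.2.1, h.2.2.1⟩, fun h => ⟨h.1, h.2.1, h.2.2, ?_⟩⟩
    have h1 : x.1 ∈ R F := mem_R_iff.2 h.1
    have h2' : x.2.1 ∈ R F := mem_R_iff.2 h.2.1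
    have h3 : x.2.2 ∈ R F := mem_R_iff.2 h.2.2
    exact mem_R_iff.1 (sub_mem (sub_mem (pow_mem (mem_R_iff.2 hα) 2)
      (mul_mem (mul_mem (mem_R_iff.2 h2.le) h1) h3)) (pow_mem h2' 2))
  have hfun : (orbitalSupport α 1).indicator (fun x => (ψ x.2.1 : ℂ)) =
      (orbitalSupport α 1).indicator fun _ => (1 : ℂ) := by
    refine Set.indicator_congr fun x hx => ?_
    rw [hψ _ (mem_R_iff.2 hx.2.1), Circle.coe_one]
  rw [hfun, integral_indicator_const _ (isCompact_orbitalSupport α 1).measurableSet, Measure.real,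
    hset, Measure.prod_prod, Measure.prod_prod, hμ]
  simp

theorem integral_orbitalSupport_q (h2 : ‖(2 : F)‖ = 1) (hϖ : IsUniformizer ϖ)
    (h_norm : ‖(ϖ : F)‖ = (q F : ℝ)⁻¹) (μ : Measure F) [μ.IsAddHaarMeasure]
    (hμ : μ {x : F | ‖x‖ ≤ 1} = 1) {ψ : AddChar F Circle} (hψ_cont : Continuous ψ)
    (hψ : HasConductorR ψ ϖ) {α : F} (hα : ‖α‖ ≤ 1) :
    ∫ x, (orbitalSupport α (q F)).indicator (fun x => (ψ x.2.1 : ℂ)) x ∂(μ.prod (μ.prod μ)) =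
      q F := by
  have hq := hϖ.one_lt_q h_norm
  have hq0 := zero_lt_one.trans hq
  have hmeas : ∀ c : ℝ, MeasurableSet {x : F | ‖x‖ ≤ c} := fun c =>
    (isClosed_le continuous_norm continuous_const).measurableSet
  obtain ⟨t, ht, htψ⟩ := hψ.exists_norm_le h_norm
  rw [integral_orbitalSupport μ α _ (f := fun y => (ψ y : ℂ)) (by fun_prop),
    ← integral_indicator (hmeas _)]
  have hslice : ∀ s : F, {s : F | ‖s‖ ≤ q F}.indicator (fun s =>
      ∫ p, (orbitalSlice α (q F) s).indicator (fun p => (ψ p.1 : ℂ)) p ∂(μ.prod μ)) s =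
      {s : F | ‖s‖ ≤ 1}.indicator (fun _ => (q F : ℂ)) s := by
    intro s
    classical
    simp only [Set.indicator_apply, Set.mem_ofPred_eq]
    by_cases hs : ‖s‖ ≤ 1
    · rw [if_pos (hs.trans hq.le), if_pos hs]
      have hset : orbitalSlice α (q F) s = {x : F | ‖x‖ ≤ 1} ×ˢ {x : F | ‖x‖ ≤ q F} := by
        ext p
        exact mem_orbitalSlice_q_iff h2 hϖ h_norm hα hs
      have hfun : (orbitalSlice α (q F) s).indicator (fun p => (ψ p.1 : ℂ)) =
          (orbitalSlice α (q F) s).indicator fun _ => (1 : ℂ) := by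
        refine Set.indicator_congr fun p hp => ?_
        rw [hset] at hp
        rw [hψ.1 _ (mem_R_iff.2 hp.1), Circle.coe_one]
      change ∫ p, (orbitalSlice α (q F) s).indicator (fun p => (ψ p.1 : ℂ)) p ∂(μ.prod μ) = _
      rw [hfun, integral_indicator_const _ (isCompact_orbitalSlice α _ s).measurableSet,
        Measure.real, hset, Measure.prod_prod, hμ, hϖ.measure_norm_le_q h_norm μ hμ]
      simp
    · rw [if_neg hs]
      split_ifs with hsq
      · have hs' : ‖s‖ = q F := by
          refine le_antisymm hsq (not_lt.1 fun hlt => hs ?_)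
          have h' := hϖ.mul_norm_le_of_norm_lt_zpow h_norm (k := 1) (by rwa [zpow_one])
          rwa [zpow_one, mul_le_iff_le_one_right hq0] at h'
        exact integral_orbitalSlice_eq_zero_of_norm_eq h2 μ hμ hψ_cont htψ hq.le ht
          (hα.trans hq.le) hs'
      · rfl
  simp only [hslice]
  rw [integral_indicator_const _ (hmeas _), Measure.real, hμ, ENNReal.toReal_one, one_smul]

theorem integral_orbitalSupport_pow (h2 : ‖(2 : F)‖ = 1) (hϖ : IsUniformizer ϖ)
    (h_norm : ‖(ϖ : F)‖ = (q F : ℝ)⁻¹) (μ : Measure F) [μ.IsAddHaarMeasure]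
    (hμ : μ {x : F | ‖x‖ ≤ 1} = 1) {ψ : AddChar F Circle} (hψ_cont : Continuous ψ)
    (hψ : HasConductorR ψ ϖ) {N : ℕ} (hN : 2 ≤ N) {α : F} (hα : ‖α‖ < (q F : ℝ) ^ N) :
    ∫ x, (orbitalSupport α ((q F : ℝ) ^ N)).indicator (fun x => (ψ x.2.1 : ℂ)) x
      ∂(μ.prod (μ.prod μ)) = 0 := by
  have hq := hϖ.one_lt_q h_norm
  obtain ⟨t, ht, htψ⟩ := hψ.exists_norm_le h_norm
  have hqA : (q F : ℝ) ≤ (q F : ℝ) ^ N := le_self_pow₀ hq.le (by omega)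
  rw [integral_orbitalSupport μ α _ (f := fun y => (ψ y : ℂ)) (by fun_prop)]
  refine setIntegral_eq_zero_of_forall_eq_zero fun s hs => ?_
  rcases (show ‖s‖ ≤ _ from hs).eq_or_lt with hs | hs
  · exact integral_orbitalSlice_eq_zero_of_norm_eq h2 μ hμ hψ_cont htψ (hq.le.trans hqA)
      (ht.trans hqA) hα.le hs
  · refine integral_eq_zero_of_add_eq_mul (μ.prod μ) _ (t, (0 : F)) (c := (ψ t : ℂ))
      (by simpa [Circle.coe_eq_one] using htψ) fun p => ?_
    have hmem : (t, (0 : F)) + p ∈ orbitalSlice α ((q F : ℝ) ^ N) s ↔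
        p ∈ orbitalSlice α ((q F : ℝ) ^ N) s := by
      refine ⟨fun h => ?_, add_mem_orbitalSlice h2 hϖ h_norm hN ht hα hs⟩
      have h' := add_mem_orbitalSlice h2 hϖ h_norm hN (t := -t) (by rwa [norm_neg]) hα hs h
      have hp : (-t, (0 : F)) + ((t, (0 : F)) + p) = p := by ext <;> simp
      rwa [hp] at h'
    classical
    simp only [Set.indicator_apply, hmem, Prod.fst_add, AddChar.map_add_eq_mul, Circle.coe_mul,
      mul_ite, mul_zero]

theorem integrable_orbitalIntegrand_Φ (h2 : ‖(2 : F)‖ = 1) (hϖ : IsUniformizer ϖ)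
    (h_norm : ‖(ϖ : F)‖ = (q F : ℝ)⁻¹) (μ : Measure F) [μ.IsAddHaarMeasure]
    {ψ : AddChar F Circle} (hψ_cont : Continuous ψ) (r : ℕ) (α : Fˣ) :
    Integrable (orbitalIntegrand ψ (Φ ϖ r) α) (μ.prod (μ.prod μ)) := by
  rw [Φ_eq_indicator h2 hϖ h_norm, orbitalIntegrand_indicator h2]
  split_ifs
  · exact integrable_indicator_of_isCompact (isCompact_orbitalSupport _ _) (by fun_prop)
  · exact integrable_zero _ _ _

/-- The orbital integral of `Φ_r` is supported on two cosets of the unit group. -/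
theorem Ψ_Φ (h2 : ‖(2 : F)‖ = 1) (hϖ : IsUniformizer ϖ)
    (h_norm : ‖(ϖ : F)‖ = (q F : ℝ)⁻¹) (μ : Measure F) [μ.IsAddHaarMeasure]
    (hμ : μ {x : F | ‖x‖ ≤ 1} = 1) {ψ : AddChar F Circle} (hψ_cont : Continuous ψ)
    (hψ : HasConductorR ψ ϖ) {r : ℕ} (hr : 1 ≤ r) (α : Fˣ) :
    Ψ μ ψ (Φ ϖ r) α = {α : Fˣ | ‖(α : F)‖ = (q F : ℝ) ^ (-(r : ℤ))}.indicator 1 α +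
      q F * {α : Fˣ | ‖(α : F)‖ = (q F : ℝ) ^ (1 - (r : ℤ))}.indicator 1 α := by
  have hq := hϖ.one_lt_q h_norm
  have hq0 := zero_lt_one.trans hq
  obtain ⟨k, hk⟩ := hϖ.exists_norm_eq_zpow h_norm α.ne_zero
  have hA : (q F : ℝ) ^ r * ‖(α : F)‖ = (q F : ℝ) ^ (r + k) := by
    rw [hk, ← zpow_natCast, ← zpow_add₀ hq0.ne']
  classical
  rw [Ψ, Φ_eq_indicator h2 hϖ h_norm, orbitalIntegrand_indicator h2, hA]
  simp only [Set.indicator_apply (M := ℂ) _ 1, Set.mem_ofPred_eq, hk,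
    zpow_right_inj₀ hq0 hq.ne', one_le_zpow_iff_right₀ hq, Pi.one_apply]
  by_cases hN : 0 ≤ (r : ℤ) + k
  · obtain ⟨N, hN'⟩ := Int.eq_ofNat_of_zero_le hN
    rw [if_pos hN, hN']
    obtain rfl : k = N - r := by omega
    have hα : ‖(α : F)‖ < (q F : ℝ) ^ N := by
      rw [hk, ← zpow_natCast]
      exact zpow_lt_zpow_right₀ hq (by omega)
    rcases N with _ | _ | N
    · rw [if_pos (by simp), if_neg (by omega)]
      simpa using integral_orbitalSupport_one h2 μ hμ hψ.1 (by simpa using hα.le)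
    · rw [if_neg (by omega), if_pos (by simp)]
      have hα1 : ‖(α : F)‖ ≤ 1 := by
        rw [hk]
        exact zpow_le_one_of_nonpos₀ hq.le (by omega)
      simpa using integral_orbitalSupport_q h2 hϖ h_norm μ hμ hψ_cont hψ hα1
    · rw [if_neg (by omega), if_neg (by omega), zpow_natCast,
        integral_orbitalSupport_pow h2 hϖ h_norm μ hμ hψ_cont hψ (by omega) hα]
      simp
  · rw [if_neg hN, if_neg (by omega), if_neg (by omega)]
    simp

end OrbitalIntegralValues

section Mellin

variable {F : Type*} [NontriviallyNormedField F]

instance [MeasurableSpace F] [BorelSpace F] : BorelSpace Fˣ := by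
  refine ⟨?_⟩
  rw [Units.isEmbedding_val₀.eq_induced, borel_comap, ← BorelSpace.measurable_eq (α := F)]
  rfl

theorem isCompact_units_norm_eq [ProperSpace F] {c : ℝ} (hc : c ≠ 0) :
    IsCompact {u : Fˣ | ‖(u : F)‖ = c} := by
  have himage : (Units.val '' {u : Fˣ | ‖(u : F)‖ = c}) = Metric.sphere (0 : F) c := by
    ext x
    rw [mem_sphere_zero_iff_norm]
    constructor
    · rintro ⟨u, hu, rfl⟩
      exact hu
    · intro hx
      exact ⟨Units.mk0 x (norm_ne_zero_iff.1 (hx ▸ hc)), hx, rfl⟩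
  rw [Units.isEmbedding_val₀.isCompact_iff, himage]
  exact isCompact_sphere _ _

variable [MeasurableSpace F] [BorelSpace F] {ϖ : Fˣ}

theorem measure_units_norm_eq_zpow [IsUltrametricDist F] (h_norm : ‖(ϖ : F)‖ = (q F : ℝ)⁻¹)
    (ν : Measure Fˣ) [ν.IsHaarMeasure] (hν : ν {u : Fˣ | ‖(u : F)‖ = 1} = 1) (k : ℤ) :
    ν {u : Fˣ | ‖(u : F)‖ = (q F : ℝ) ^ k} = 1 := by
  have hset : {u : Fˣ | ‖(u : F)‖ = (q F : ℝ) ^ k} =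
      (fun u => ϖ ^ k * u) ⁻¹' {u : Fˣ | ‖(u : F)‖ = 1} := by
    have hq : (q F : ℝ) ^ k ≠ 0 := by
      rw [← inv_inv (q F : ℝ), ← h_norm]
      exact zpow_ne_zero _ (inv_ne_zero (norm_ne_zero_iff.2 ϖ.ne_zero))
    ext u
    rw [Set.mem_preimage, Set.mem_ofPred_eq, Set.mem_ofPred_eq, Units.val_mul, norm_mul,
      Units.val_zpow_eq_zpow_val, norm_zpow, h_norm, inv_zpow, inv_mul_eq_one₀ hq, eq_comm]
  rw [hset, measure_preimage_mul, hν]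

theorem setIntegral_unramified [IsUltrametricDist F] (h_norm : ‖(ϖ : F)‖ = (q F : ℝ)⁻¹)
    (ν : Measure Fˣ) [ν.IsHaarMeasure] (hν : ν {u : Fˣ | ‖(u : F)‖ = 1} = 1)
    {χ : Fˣ →* ℂˣ} (hχ : IsUnramified χ) (k : ℤ) :
    ∫ α in {α : Fˣ | ‖(α : F)‖ = (q F : ℝ) ^ k}, (χ α : ℂ) ∂ν = (χ ϖ : ℂ)⁻¹ ^ k := by
  have hmeas : MeasurableSet {α : Fˣ | ‖(α : F)‖ = (q F : ℝ) ^ k} :=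
    (isClosed_eq (continuous_norm.comp Units.continuous_val) continuous_const).measurableSet
  have hconst : ∀ α ∈ {α : Fˣ | ‖(α : F)‖ = (q F : ℝ) ^ k}, (χ α : ℂ) = (χ ϖ : ℂ)⁻¹ ^ k := by
    intro α hα
    have hq : (q F : ℝ) ^ k ≠ 0 := (show _ = _ from hα) ▸ norm_ne_zero_iff.2 α.ne_zero
    have h1 := hχ (ϖ ^ k * α) (by
      rw [Units.val_mul, norm_mul, Units.val_zpow_eq_zpow_val, norm_zpow, h_norm, inv_zpow,
        show ‖(α : F)‖ = _ from hα, inv_mul_cancel₀ hq])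
    rw [map_mul, map_zpow, mul_eq_one_iff_inv_eq] at h1
    rw [← h1, Units.val_inv_eq_inv_val, Units.val_zpow_eq_zpow_val, inv_zpow]
  rw [setIntegral_congr_fun hmeas hconst, setIntegral_const, Measure.real,
    measure_units_norm_eq_zpow h_norm ν hν, ENNReal.toReal_one, one_smul]

theorem setIntegral_ramified (ν : Measure Fˣ) [ν.IsHaarMeasure]
    {χ : Fˣ →* ℂˣ} (hχ : ¬ IsUnramified χ) (c : ℝ) :
    ∫ α in {α : Fˣ | ‖(α : F)‖ = c}, (χ α : ℂ) ∂ν = 0 := by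
  have hmeas : MeasurableSet {α : Fˣ | ‖(α : F)‖ = c} :=
    (isClosed_eq (continuous_norm.comp Units.continuous_val) continuous_const).measurableSet
  obtain ⟨u, hu, hne⟩ : ∃ u : Fˣ, ‖(u : F)‖ = 1 ∧ χ u ≠ 1 := by
    simpa [IsUnramified] using hχ
  rw [← integral_indicator hmeas]
  refine integral_eq_zero_of_mul_eq_mul ν _ u (c := (χ u : ℂ)) (by simpa using hne) fun α => ?_
  classical
  simp only [Set.indicator_apply, Set.mem_ofPred_eq, Units.val_mul, norm_mul, hu, one_mul, map_mul,
    mul_ite, mul_zero]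

end Mellin

end OrbitalIntegral

end

theorem proposition3p5
    {F : Type*} [NontriviallyNormedField F] [IsUltrametricDist F] [ProperSpace F]
    [MeasurableSpace F] [BorelSpace F]
    (h_two : (2 : OrbitalIntegral.Residue F) ≠ 0)
    (ϖ : Fˣ) (hϖ : OrbitalIntegral.IsUniformizer ϖ)
    (h_norm : ‖(ϖ : F)‖ = (OrbitalIntegral.q F : ℝ)⁻¹)
    (μ : Measure F) [μ.IsAddHaarMeasure] (hμ : μ {x : F | ‖x‖ ≤ 1} = 1)
    (ν : Measure Fˣ) [ν.IsHaarMeasure] (hν : ν {u : Fˣ | ‖(u : F)‖ = 1} = 1)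
    (ψ : AddChar F Circle) (hψ_cont : Continuous ψ) (hψ : OrbitalIntegral.HasConductorR ψ ϖ)
    (χ : Fˣ →* ℂˣ) (hχ : Continuous χ)
    (r : ℕ) (hr : 1 ≤ r) :
    OrbitalIntegral.Φ ϖ r =
        {v : Fin 5 → F | v ∈ OrbitalIntegral.S F ∧
          ∀ i, ‖v i‖ ≤ (OrbitalIntegral.q F : ℝ) ^ r}.indicator (fun _ => (1 : ℂ)) ∧
    (∀ α : Fˣ, Integrable
        (OrbitalIntegral.orbitalIntegrand ψ (OrbitalIntegral.Φ ϖ r) α) (μ.prod (μ.prod μ))) ∧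
    Integrable
        (fun α : Fˣ => OrbitalIntegral.Ψ μ ψ (OrbitalIntegral.Φ ϖ r) α * (χ α : ℂ)) ν ∧
    (OrbitalIntegral.IsUnramified χ → ∀ X : ℂ, X = ((χ ϖ : ℂˣ) : ℂ)⁻¹ →
      ∫ α : Fˣ, OrbitalIntegral.Ψ μ ψ (OrbitalIntegral.Φ ϖ r) α * (χ α : ℂ) ∂ν =
        (OrbitalIntegral.q F : ℂ) * X ^ (1 - (r : ℤ)) + X ^ (-(r : ℤ))) ∧
    (¬ OrbitalIntegral.IsUnramified χ →
      ∫ α : Fˣ, OrbitalIntegral.Ψ μ ψ (OrbitalIntegral.Φ ϖ r) α * (χ α : ℂ) ∂ν = 0) := by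
  open OrbitalIntegral in
  have h2 := norm_two h_two
  have hq0 := zero_lt_one.trans (hϖ.one_lt_q h_norm)
  let U : ℤ → Set Fˣ := fun k => {α : Fˣ | ‖(α : F)‖ = (q F : ℝ) ^ k}
  have hU : ∀ k, IsCompact (U k) := fun k => isCompact_units_norm_eq (zpow_ne_zero k hq0.ne')
  have hχ' : Continuous fun α => (χ α : ℂ) := Units.continuous_val.comp hχ
  have hfun : (fun α : Fˣ => Ψ μ ψ (Φ ϖ r) α * (χ α : ℂ)) = fun α =>
      (U (-(r : ℤ))).indicator (fun α => (χ α : ℂ)) α +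
        (q F : ℂ) * (U (1 - (r : ℤ))).indicator (fun α => (χ α : ℂ)) α := by
    funext α
    classical
    rw [Ψ_Φ h2 hϖ h_norm μ hμ hψ_cont hψ hr]
    simp only [U, Set.indicator_apply, Pi.one_apply, add_mul, mul_assoc, ite_mul, one_mul, zero_mul]
  have hint : ∀ k, Integrable ((U k).indicator fun α => (χ α : ℂ)) ν := fun k =>
    integrable_indicator_of_isCompact (hU k) hχ'
  have hval : ∫ α : Fˣ, Ψ μ ψ (Φ ϖ r) α * (χ α : ℂ) ∂ν =
      (∫ α in U (-(r : ℤ)), (χ α : ℂ) ∂ν) + (q F : ℂ) * ∫ α in U (1 - (r : ℤ)), (χ α : ℂ) ∂ν := by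
    rw [hfun, integral_add (hint _) ((hint _).const_mul _), integral_const_mul,
      integral_indicator (hU _).measurableSet, integral_indicator (hU _).measurableSet]
  refine ⟨Φ_eq_indicator h2 hϖ h_norm r, integrable_orbitalIntegrand_Φ h2 hϖ h_norm μ hψ_cont r,
    ?_, fun hu X hX => ?_, fun hu => ?_⟩
  · rw [hfun]
    exact (hint _).add ((hint _).const_mul _)
  · rw [hval, hX, setIntegral_unramified h_norm ν hν hu, setIntegral_unramified h_norm ν hν hu,
      add_comm]
  · rw [hval, setIntegral_ramified ν hu, setIntegral_ramified ν hu, mul_zero, add_zero]
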